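/- Let $n\ge 2$, let $M_0$ be a connected smooth manifold of dimension $n-1$, let $I\subset\mathbb{R}$ be an open interval, and let $M^n=M_0\times I$, with product net $\mathcal{E}=(E_0,E_1)$, where $E_0$ and $E_1$ are the distributions tangent to the factors $M_0$ and $I$. The leaves of $E_0$ are the sets $M_0\times\{s\}$, and a prime denotes the derivative with respect to $s\in I$. A hypersurface (smooth immersion) $f\colon M^n\to\mathbb{R}^{n+1}$ with Gauss map (smooth unit normal field) $N\colon M^n\to\mathbb{S}^n$ is called of Enneper type with respect to $\mathcal{E}$ if (i) $E_0$ and $E_1$ are orthogonal with respect to the metric induced by $f$; (ii) the second fundamental form of $f$ satisfies $\mathrm{II}(X,Y)=0$ for $X\in E_0$, $Y\in E_1$; (iii) the image by $f$ of each leaf of $E_0$ is contained in a hypersphere of $\mathbb{R}^{n+1}$. Let $f\colon M^n\to\mathbb{R}^{n+1}$ be a hypersurface of Enneper type with respect to $\mathcal{E}$. Assume that its Gauss map $N$ is a local diffeomorphism whose induced metric has the form $d\sigma^2=g_s+\rho^2ds^2$, with $\rho\in C^\infty(M)$ and $g_s$ a smooth family of metrics on $M_0$ indexed by $s\in I$,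 and that $$f=\gamma+\alpha N+\beta\rho^{-1}N_*\partial_s \qquad (1)$$ for a smooth regular curve $\gamma\colon I\to\mathbb{R}^{n+1}$ (so $\gamma'$ vanishes nowhere) and functions $\alpha,\beta\in C^\infty(I)$ that satisfy $$\langle\gamma',N\rangle+\alpha'=\beta\rho. \qquad (2)$$ Suppose also that there is no leaf of $E_0$ whose image by $f$ is an open piece of (possibly all of) a round $(n-1)$-dimensional sphere, that is, of a sphere of positive radius in an affine hyperplane of $\mathbb{R}^{n+1}$. Then for every hypersurface $\bar f\colon M^n\to\mathbb{R}^{n+1}$ of Enneper type with respect to $\mathcal{E}$ that has $N$ as a Gauss map, there exist a smooth curve $\bar\gamma\colon I\to\mathbb{R}^{n+1}$ and functions $\bar\alpha,\bar\beta,\lambda\in C^\infty(I)$ such that (1) and (2) hold for $\bar f$ and $(\bar\gamma,\bar\alpha,\bar\beta)$ in place of $f$ and $(\gamma,\alpha,\beta)$, and $$\bar\beta=\lambda\beta,\qquad \bar\alpha'=\lambda\alpha',\qquad \bar\gamma'=\lambda\gamma'.$$ -/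

import Mathlib

open scoped Manifold ContDiff

noncomputable section

/-- The model with corners of the product of an `(n-1)`-dimensional manifold with the real line. -/
abbrev prodModel (n : ℕ) :
    ModelWithCorners ℝ (EuclideanSpace ℝ (Fin (n - 1)) × ℝ)
      (ModelProd (EuclideanSpace ℝ (Fin (n - 1))) ℝ) :=
  (𝓡 (n - 1)).prod 𝓘(ℝ, ℝ)

section Defs

variable {n : ℕ} {M₀ : Type*} [TopologicalSpace M₀]
  [ChartedSpace (EuclideanSpace ℝ (Fin (n - 1))) M₀]

/-- The differential of `f : M₀ × J → ℝⁿ⁺¹` at `p`. A map on `M₀ × J`, for `J` an open interval, is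
given as a map on `M₀ × ℝ`, of which only the values over `J` are ever used; a tangent vector of
`M₀ × J` at `p` is a pair of a tangent vector of `M₀` and a real number (a multiple of `∂ₛ`). -/
def pushforward (f : M₀ × ℝ → EuclideanSpace ℝ (Fin (n + 1))) (p : M₀ × ℝ) :
    TangentSpace (𝓡 (n - 1)) p.1 × ℝ →L[ℝ] EuclideanSpace ℝ (Fin (n + 1)) :=
  mfderiv (prodModel n) 𝓘(ℝ, EuclideanSpace ℝ (Fin (n + 1))) f p

/-- A sphere-valued map, viewed as a map into the ambient Euclidean space. -/
def ambient (N : M₀ × ℝ → Metric.sphere (0 : EuclideanSpace ℝ (Fin (n + 1))) 1) (p : M₀ × ℝ) :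
    EuclideanSpace ℝ (Fin (n + 1)) :=
  (N p : EuclideanSpace ℝ (Fin (n + 1)))

/-- `f : M₀ × J → ℝⁿ⁺¹` is a hypersurface: a smooth map with injective differentials. -/
structure IsHypersurface (J : Set ℝ) (f : M₀ × ℝ → EuclideanSpace ℝ (Fin (n + 1))) : Prop where
  smooth : ContMDiffOn (prodModel n) 𝓘(ℝ, EuclideanSpace ℝ (Fin (n + 1))) ∞ f (Set.univ ×ˢ J)
  immersion : ∀ x : M₀, ∀ s ∈ J, Function.Injective (pushforward f (x, s))

/-- `N : M₀ × J → 𝕊ⁿ` is a Gauss map of `f`: a smooth unit normal vector field. -/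
structure IsGaussMap (J : Set ℝ) (f : M₀ × ℝ → EuclideanSpace ℝ (Fin (n + 1)))
    (N : M₀ × ℝ → Metric.sphere (0 : EuclideanSpace ℝ (Fin (n + 1))) 1) : Prop where
  smooth : ContMDiffOn (prodModel n) (𝓡 n) ∞ N (Set.univ ×ˢ J)
  normal : ∀ x : M₀, ∀ s ∈ J, ∀ v : TangentSpace (𝓡 (n - 1)) x × ℝ,
    inner ℝ (pushforward f (x, s) v) (ambient N (x, s)) = 0

/-- The metric `⟨u, v⟩ = ⟨f_* u, f_* v⟩` induced by `f`. -/
def inducedMetric (f : M₀ × ℝ → EuclideanSpace ℝ (Fin (n + 1))) (p : M₀ × ℝ)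
    (u v : TangentSpace (𝓡 (n - 1)) p.1 × ℝ) : ℝ :=
  inner ℝ (pushforward f p u) (pushforward f p v)

/-- The second fundamental form `⟨A u, v⟩` of `f` with respect to its Gauss map `N`, where `A` is
the shape operator, `f_* A u = - N_* u`. -/
def secondFundamentalForm (f : M₀ × ℝ → EuclideanSpace ℝ (Fin (n + 1)))
    (N : M₀ × ℝ → Metric.sphere (0 : EuclideanSpace ℝ (Fin (n + 1))) 1) (p : M₀ × ℝ)
    (u v : TangentSpace (𝓡 (n - 1)) p.1 × ℝ) : ℝ :=
  inner ℝ (-pushforward (ambient N) p u) (pushforward f p v)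

/-- `f` is a hypersurface of Enneper type with respect to the product net `(E₀, E₁)` of `M₀ × J`
(`E₀` consists of the vectors `(X, 0)` and `E₁` of the vectors `(0, a)`), with Gauss map `N`. -/
structure IsEnneperType (J : Set ℝ) (f : M₀ × ℝ → EuclideanSpace ℝ (Fin (n + 1)))
    (N : M₀ × ℝ → Metric.sphere (0 : EuclideanSpace ℝ (Fin (n + 1))) 1) : Prop where
  hypersurface : IsHypersurface J f
  gaussMap : IsGaussMap J f N
  /-- The net is orthogonal with respect to the metric induced by `f`. -/
  orthogonal : ∀ x : M₀, ∀ s ∈ J, ∀ (X : TangentSpace (𝓡 (n - 1)) x) (a : ℝ),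
    inducedMetric f (x, s) (X, 0) (0, a) = 0
  /-- The second fundamental form of `f` is adapted to the net. -/
  adapted : ∀ x : M₀, ∀ s ∈ J, ∀ (X : TangentSpace (𝓡 (n - 1)) x) (a : ℝ),
    secondFundamentalForm f N (x, s) (X, 0) (0, a) = 0 ∧
      secondFundamentalForm f N (x, s) (0, a) (X, 0) = 0
  /-- The image by `f` of each leaf `M₀ × {s}` of `E₀` is contained in a hypersphere. -/
  spherical : ∀ s ∈ J, ∃ (c : EuclideanSpace ℝ (Fin (n + 1))) (r : ℝ), 0 < r ∧
    ∀ x : M₀, f (x, s) ∈ Metric.sphere c r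

/-- The metric `dσ²` induced by `N` has the form `g_s + ρ² ds²`, for a smooth function `ρ` and a
family of metrics `g_s` on `M₀`. The metric `g_s` can only be the one that `N` induces on the leaf
`M₀ × {s}`; it is therefore written as such. -/
structure HasSplitMetric (J : Set ℝ)
    (N : M₀ × ℝ → Metric.sphere (0 : EuclideanSpace ℝ (Fin (n + 1))) 1)
    (ρ : M₀ × ℝ → ℝ) : Prop where
  smooth : ContMDiffOn (prodModel n) 𝓘(ℝ, ℝ) ∞ ρ (Set.univ ×ˢ J)
  metric_eq : ∀ x : M₀, ∀ s ∈ J, ∀ (X Y : TangentSpace (𝓡 (n - 1)) x) (a b : ℝ),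
    inducedMetric (ambient N) (x, s) (X, a) (Y, b) =
      inducedMetric (ambient N) (x, s) (X, 0) (Y, 0) + ρ (x, s) ^ 2 * (a * b)

/-- `f` is parametrized in terms of `N` (with `dσ² = g_s + ρ² ds²`) and the triple `(γ, α, β)`:
`f = γ + α N + β ρ⁻¹ N_* ∂ₛ`, where `⟨γ', N⟩ + α' = β ρ`. -/
structure IsParametrizedBy (J : Set ℝ)
    (N : M₀ × ℝ → Metric.sphere (0 : EuclideanSpace ℝ (Fin (n + 1))) 1) (ρ : M₀ × ℝ → ℝ)
    (f : M₀ × ℝ → EuclideanSpace ℝ (Fin (n + 1)))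
    (γ : ℝ → EuclideanSpace ℝ (Fin (n + 1))) (α β : ℝ → ℝ) : Prop where
  smooth_γ : ContDiffOn ℝ ∞ γ J
  smooth_α : ContDiffOn ℝ ∞ α J
  smooth_β : ContDiffOn ℝ ∞ β J
  param : ∀ x : M₀, ∀ s ∈ J,
    f (x, s) = γ s + α s • ambient N (x, s) +
      (β s * (ρ (x, s))⁻¹) • pushforward (ambient N) (x, s) (0, 1)
  compat : ∀ x : M₀, ∀ s ∈ J,
    inner ℝ (deriv γ s) (ambient N (x, s)) + deriv α s = β s * ρ (x, s)

end Defs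

/-- The round `(n-1)`-spheres of `ℝⁿ⁺¹`: the spheres, of positive radius, of its affine
hyperplanes (`c` is the centre, `r` the radius and `h` a normal vector of the hyperplane). -/
def IsRoundSphere {n : ℕ} (S : Set (EuclideanSpace ℝ (Fin (n + 1)))) : Prop :=
  ∃ (c h : EuclideanSpace ℝ (Fin (n + 1))) (r : ℝ), h ≠ 0 ∧ 0 < r ∧
    S = {y | dist y c = r ∧ inner ℝ h (y - c) = 0}

/-- `A` is an open piece of a round `(n-1)`-sphere of `ℝⁿ⁺¹`, possibly all of it. -/
def IsOpenPieceOfRoundSphere {n : ℕ} (A : Set (EuclideanSpace ℝ (Fin (n + 1)))) : Prop :=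
  ∃ S U : Set (EuclideanSpace ℝ (Fin (n + 1))), IsRoundSphere S ∧ IsOpen U ∧ A = S ∩ U

end

/-! Write `ν = ρ⁻¹ N_* ∂ₛ` (`unitField`). The split metric makes `N, ν` orthonormal and orthogonal
to `N_* E₀`. Normality and adaptedness of the second fundamental form make them orthogonal to `f_*
E₀` as well. By dimension, every Enneper hypersurface with Gauss map `N` has the same leaf tangent
spaces as `N` (`IsEnneperType.range_leafDeriv`). Hence a leaf of one lies in a hyperplane orthogonal
to `w` exactly when the leaf of `N` does. A planar leaf of `f` is also spherical, so it is an open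
piece of a round sphere, which is excluded. Thus no leaf of `N`, and none of `f̄`, lies in a
hyperplane.

If a leaf of `f̄` lies in a sphere of centre `c`, then `f̄ - c` is normal to the leaf, so `f̄ - c =
a N + b ν`. Here `a` has zero derivative along the leaf, and `b² = r² - a²`, so by connectedness `a`
and `b` are functions of `s`. Therefore `γ̄ = c`, the curve of centres, gives (1). It is smooth
because the leaves affinely span the space (`contDiffAt_center`). Differentiating (1) in `s` and
pairing with `N` gives (2).

If `β s = 0`, then (2) makes `⟨γ', N⟩` constant on a leaf, so `γ' = 0`, a contradiction. With `λ = b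
/ β`, subtracting `λ` times (2) for `f` from (2) for `f̄` gives `⟨c' - λ γ', N⟩ = λ α' - a'`,
constant on the leaf. Nonplanarity forces `c' = λ γ'`, and then `a' = λ α'`. -/

noncomputable section

/-! ### Calculus on `M₀ × ℝ` in charts, along leaves and along lines. -/

section LeafCalculus

variable {n : ℕ} {M₀ : Type*} [TopologicalSpace M₀]
  [ChartedSpace (EuclideanSpace ℝ (Fin (n - 1))) M₀]
  {V : Type*} [NormedAddCommGroup V] [NormedSpace ℝ V]

/-- The expression of a map on `M₀ × ℝ` in the preferred chart of `M₀` at `x`. -/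
def chartRep (F : M₀ × ℝ → V) (x : M₀) (q : EuclideanSpace ℝ (Fin (n - 1)) × ℝ) : V :=
  F ((chartAt (EuclideanSpace ℝ (Fin (n - 1))) x).symm q.1, q.2)

theorem contDiffAt_chartRep {F : M₀ × ℝ → V} {x : M₀} {s : ℝ} {k : WithTop ℕ∞}
    (hF : ContMDiffAt (prodModel n) 𝓘(ℝ, V) k F (x, s)) :
    ContDiffAt ℝ k (chartRep F x) (chartAt (EuclideanSpace ℝ (Fin (n - 1))) x x, s) := by
  have h := (contMDiffAt_iff.1 hF).2
  have hr : Set.range (prodModel n) = Set.univ := (prodModel n).range_eq_univ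
  rw [hr, contDiffWithinAt_univ] at h
  exact h

theorem mfderiv_eq_fderiv_chartRep {F : M₀ × ℝ → V} {x : M₀} {s : ℝ}
    (hF : MDifferentiableAt (prodModel n) 𝓘(ℝ, V) F (x, s)) :
    mfderiv (prodModel n) 𝓘(ℝ, V) F (x, s) =
      fderiv ℝ (chartRep F x) (chartAt (EuclideanSpace ℝ (Fin (n - 1))) x x, s) := by
  have hr : Set.range (prodModel n) = Set.univ := (prodModel n).range_eq_univ
  rw [hF.mfderiv, hr, fderivWithin_univ]
  rfl

/-- A function on a connected manifold whose derivative vanishes is constant. -/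
theorem eq_of_hasFDerivAt_chart_zero [ConnectedSpace M₀] [IsManifold (𝓡 (n - 1)) ∞ M₀] {g : M₀ → V}
    (hg : ∀ x, HasFDerivAt (fun u => g ((chartAt (EuclideanSpace ℝ (Fin (n - 1))) x).symm u))
      (0 : EuclideanSpace ℝ (Fin (n - 1)) →L[ℝ] V) (chartAt (EuclideanSpace ℝ (Fin (n - 1))) x x))
    (x y : M₀) : g x = g y := by
  have hm : ∀ x, HasMFDerivAt (𝓡 (n - 1)) 𝓘(ℝ, V) g x
      (0 : EuclideanSpace ℝ (Fin (n - 1)) →L[ℝ] V) := by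
    intro x
    refine ⟨?_, ?_⟩
    · have h1 : ContinuousAt (fun z => g ((chartAt (EuclideanSpace ℝ (Fin (n - 1))) x).symm
          (chartAt (EuclideanSpace ℝ (Fin (n - 1))) x z))) x :=
        ContinuousAt.comp (f := chartAt (EuclideanSpace ℝ (Fin (n - 1))) x)
          (hg x).continuousAt ((chartAt _ x).continuousAt (mem_chart_source _ x))
      refine h1.congr ?_
      filter_upwards [(chartAt (EuclideanSpace ℝ (Fin (n - 1))) x).open_source.mem_nhds
        (mem_chart_source _ x)] with z hz
      simp [hz]
    · have := (hg x).hasFDerivWithinAt (s := Set.range (𝓡 (n - 1)))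
      exact this
  have hloc : IsLocallyConstant g := by
    rw [IsLocallyConstant.iff_eventually_eq]
    intro x
    set e := chartAt (EuclideanSpace ℝ (Fin (n - 1))) x with he
    -- The hypothesis controls `g` only at the centre of each preferred chart; the chain rule
    -- carries this to every point of the target of one fixed chart.
    have hd : ∀ u ∈ e.target, HasFDerivAt (fun u => g (e.symm u))
        (0 : EuclideanSpace ℝ (Fin (n - 1)) →L[ℝ] V) u := by
      intro u hu
      have h1 : MDifferentiableAt (𝓡 (n - 1)) (𝓡 (n - 1)) e.symm u :=
        mdifferentiableAt_atlas_symm (chart_mem_atlas _ x) hu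
      have h2 := (hm (e.symm u)).comp u h1.hasMFDerivAt
      have h3 := hasMFDerivAt_iff_hasFDerivAt.1 h2
      exact h3.congr_fderiv (ContinuousLinearMap.zero_comp _)
    obtain ⟨ε, hε, hball⟩ := Metric.isOpen_iff.1 e.open_target (e x)
      (e.map_source (mem_chart_source _ x))
    filter_upwards [(e.continuousAt (mem_chart_source _ x)).preimage_mem_nhds
      (Metric.ball_mem_nhds _ hε), e.open_source.mem_nhds (mem_chart_source _ x)] with z hz hzs
    have := (convex_ball (e x) ε).is_const_of_fderivWithin_eq_zero (𝕜 := ℝ)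
      (f := fun u => g (e.symm u))
      (fun u hu => (hd u (hball hu)).differentiableAt.differentiableWithinAt)
      (fun u hu => (hd u (hball hu)).hasFDerivWithinAt.fderivWithin
        (Metric.isOpen_ball.uniqueDiffWithinAt hu)) hz (Metric.mem_ball_self hε)
    simpa [hzs, e] using this
  exact hloc.apply_eq_of_preconnectedSpace x y

theorem hasFDerivAt_chart_leaf {F : M₀ × ℝ → V} {x : M₀} {s : ℝ}
    (hF : ContMDiffAt (prodModel n) 𝓘(ℝ, V) ∞ F (x, s)) :
    HasStrictFDerivAt (fun u => F ((chartAt (EuclideanSpace ℝ (Fin (n - 1))) x).symm u, s))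
      ((fderiv ℝ (chartRep F x) (chartAt (EuclideanSpace ℝ (Fin (n - 1))) x x, s)).comp
        (ContinuousLinearMap.inl ℝ (EuclideanSpace ℝ (Fin (n - 1))) ℝ))
      (chartAt (EuclideanSpace ℝ (Fin (n - 1))) x x) := by
  have h := (contDiffAt_chartRep hF).hasStrictFDerivAt (by simp)
  exact HasStrictFDerivAt.comp (f := fun u => (u, s)) _ h
    ((hasStrictFDerivAt_id _).prodMk (hasStrictFDerivAt_const _ _))

theorem contDiffAt_line {F : M₀ × ℝ → V} {x : M₀} {s : ℝ} {k : WithTop ℕ∞}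
    (hF : ContMDiffAt (prodModel n) 𝓘(ℝ, V) k F (x, s)) : ContDiffAt ℝ k (fun t => F (x, t)) s := by
  have h := contDiffAt_chartRep hF
  have h2 := ContDiffAt.comp (f := fun t : ℝ =>
    (chartAt (EuclideanSpace ℝ (Fin (n - 1))) x x, t)) s h (by fun_prop)
  simpa [Function.comp_def, chartRep] using h2

theorem hasDerivAt_chartRep_line {F : M₀ × ℝ → V} {x y : M₀} {s : ℝ}
    (hy : y ∈ (chartAt (EuclideanSpace ℝ (Fin (n - 1))) x).source)
    (hF : DifferentiableAt ℝ (chartRep F x)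
      (chartAt (EuclideanSpace ℝ (Fin (n - 1))) x y, s)) :
    HasDerivAt (fun t => F (y, t))
      (fderiv ℝ (chartRep F x) (chartAt (EuclideanSpace ℝ (Fin (n - 1))) x y, s) (0, 1)) s := by
  have h2 := HasFDerivAt.comp_hasDerivAt (f := fun t : ℝ =>
    (chartAt (EuclideanSpace ℝ (Fin (n - 1))) x y, t)) s hF.hasFDerivAt
    ((hasDerivAt_const s _).prodMk (hasDerivAt_id s))
  simpa [Function.comp_def, chartRep, hy] using h2

/-- The derivative along the second factor depends continuously on the point of the leaf. -/
theorem continuousAt_deriv_line {F : M₀ × ℝ → V} {x : M₀} {s : ℝ}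
    (hF : ContMDiffAt (prodModel n) 𝓘(ℝ, V) ∞ F (x, s)) :
    ContinuousAt (fun y => deriv (fun t => F (y, t)) s) x := by
  set e := chartAt (EuclideanSpace ℝ (Fin (n - 1))) x with he
  have h := contDiffAt_chartRep hF
  have hc : ContinuousAt (fun y => (e y, s)) x :=
    (e.continuousAt (mem_chart_source _ x)).prodMk continuousAt_const
  have h1 : ContinuousAt (fun y => fderiv ℝ (chartRep F x) (e y, s) (0, 1)) x := by
    have h3 : ContinuousAt (fderiv ℝ (chartRep F x)) (e x, s) := h.continuousAt_fderiv (by simp)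
    exact (ContinuousAt.comp (f := fun y => (e y, s)) h3 hc).clm_apply continuousAt_const
  refine h1.congr ?_
  -- Differentiability is needed near the point. Regularity of order `1` persists nearby, whereas
  -- for order `∞` the neighbourhood may shrink with the order.
  have h4 : ∀ᶠ q in nhds (e x, s), DifferentiableAt ℝ (chartRep F x) q :=
    ((h.of_le (m := 1) (by simp)).eventually (by simp)).mono
      fun q hq => hq.differentiableAt (by simp)
  filter_upwards [e.open_source.mem_nhds (mem_chart_source _ x), hc.eventually h4] with y hy hd
  exact (hasDerivAt_chartRep_line hy hd).deriv.symm

end LeafCalculus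

/-! ### Differentials of maps into Euclidean space and of the Gauss map. -/

section Pushforward

variable {n : ℕ} {M₀ : Type*} [TopologicalSpace M₀]
  [ChartedSpace (EuclideanSpace ℝ (Fin (n - 1))) M₀]

/-- The differential of `f` along the leaf `M₀ × {s}`. -/
def leafDeriv (f : M₀ × ℝ → EuclideanSpace ℝ (Fin (n + 1))) (x : M₀) (s : ℝ) :
    EuclideanSpace ℝ (Fin (n - 1)) →L[ℝ] EuclideanSpace ℝ (Fin (n + 1)) :=
  (pushforward f (x, s)).comp (ContinuousLinearMap.inl ℝ (EuclideanSpace ℝ (Fin (n - 1))) ℝ)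

theorem hasStrictFDerivAt_leaf {F : M₀ × ℝ → EuclideanSpace ℝ (Fin (n + 1))} {x : M₀} {s : ℝ}
    (hF : ContMDiffAt (prodModel n) 𝓘(ℝ, EuclideanSpace ℝ (Fin (n + 1))) ∞ F (x, s)) :
    HasStrictFDerivAt (fun u => F ((chartAt (EuclideanSpace ℝ (Fin (n - 1))) x).symm u, s))
      (leafDeriv F x s)
      (chartAt (EuclideanSpace ℝ (Fin (n - 1))) x x) := by
  have h := hasFDerivAt_chart_leaf hF
  rwa [← mfderiv_eq_fderiv_chartRep (hF.mdifferentiableAt (by simp))] at h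

theorem hasDerivAt_line {F : M₀ × ℝ → EuclideanSpace ℝ (Fin (n + 1))} {x : M₀} {s : ℝ}
    (hF : ContMDiffAt (prodModel n) 𝓘(ℝ, EuclideanSpace ℝ (Fin (n + 1))) ∞ F (x, s)) :
    HasDerivAt (fun t => F (x, t)) (pushforward F (x, s) (0, 1)) s := by
  have h := hasDerivAt_chartRep_line (mem_chart_source _ x)
    ((contDiffAt_chartRep hF).differentiableAt (by simp))
  rwa [← mfderiv_eq_fderiv_chartRep (hF.mdifferentiableAt (by simp))] at h

theorem contMDiffAt_ambient {N : M₀ × ℝ → Metric.sphere (0 : EuclideanSpace ℝ (Fin (n + 1))) 1}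
    {p : M₀ × ℝ} (h : ContMDiffAt (prodModel n) (𝓡 n) ∞ N p) :
    ContMDiffAt (prodModel n) 𝓘(ℝ, EuclideanSpace ℝ (Fin (n + 1))) ∞ (ambient N) p := by
  have := Fact.mk (finrank_euclideanSpace_fin (𝕜 := ℝ) (n := n + 1))
  exact (contMDiff_coe_sphere (N p)).comp p h

theorem injective_pushforward_ambient
    {N : M₀ × ℝ → Metric.sphere (0 : EuclideanSpace ℝ (Fin (n + 1))) 1}
    {p : M₀ × ℝ} (h : IsLocalDiffeomorphAt (prodModel n) (𝓡 n) ∞ N p) :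
    Function.Injective (pushforward (ambient N) p) := by
  have := Fact.mk (finrank_euclideanSpace_fin (𝕜 := ℝ) (n := n + 1))
  have h1 : MDifferentiableAt (prodModel n) (𝓡 n) N p := h.contMDiffAt.mdifferentiableAt (by simp)
  have h2 : MDifferentiableAt (𝓡 n) 𝓘(ℝ, EuclideanSpace ℝ (Fin (n + 1)))
      (fun v : Metric.sphere (0 : EuclideanSpace ℝ (Fin (n + 1))) 1 =>
        (v : EuclideanSpace ℝ (Fin (n + 1)))) (N p) :=
    (contMDiff_coe_sphere (n := n) (m := ∞) (N p)).mdifferentiableAt (by simp)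
  have h3 : pushforward (ambient N) p = _ := mfderiv_comp p h2 h1
  rw [h3]
  have h4 : Function.Injective (mfderiv (prodModel n) (𝓡 n) N p) := by
    rw [← h.mfderivToContinuousLinearEquiv_coe (by simp)]
    exact ContinuousLinearEquiv.injective _
  have h5 : Function.Injective (mfderiv (𝓡 n) 𝓘(ℝ, EuclideanSpace ℝ (Fin (n + 1)))
      (fun v : Metric.sphere (0 : EuclideanSpace ℝ (Fin (n + 1))) 1 =>
        (v : EuclideanSpace ℝ (Fin (n + 1)))) (N p)) :=
    injective_mvfderiv_subtypeVal_sphere (N p)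
  exact h5.comp h4

end Pushforward

/-! ### Linear algebra of a codimension-two subspace. -/

section Frame

variable {n : ℕ}

/-- In `ℝⁿ⁺¹`, the image of an injective linear map of an `(n-1)`-dimensional space that is
orthogonal to two orthonormal vectors is their orthogonal complement. -/
theorem range_eq_orthogonal_pair (hn : 2 ≤ n) {p q : EuclideanSpace ℝ (Fin (n + 1))}
    (hpq : Orthonormal ℝ ![p, q])
    (A : EuclideanSpace ℝ (Fin (n - 1)) →L[ℝ] EuclideanSpace ℝ (Fin (n + 1)))
    (hA : Function.Injective A) (hp : ∀ v, inner ℝ (A v) p = 0) (hq : ∀ v, inner ℝ (A v) q = 0) :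
    LinearMap.range A.toLinearMap = (Submodule.span ℝ (Set.range ![p, q]))ᗮ := by
  have h1 : LinearMap.range A.toLinearMap ≤ (Submodule.span ℝ (Set.range ![p, q]))ᗮ := by
    rintro _ ⟨v, rfl⟩
    rw [Submodule.mem_orthogonal']
    intro u hu
    induction hu using Submodule.span_induction with
    | mem u hu =>
      obtain ⟨i, rfl⟩ := hu
      fin_cases i
      · exact hp v
      · exact hq v
    | zero => simp
    | add a b _ _ ha hb => rw [inner_add_right, ha, hb, add_zero]
    | smul r a _ ha => rw [inner_smul_right, ha, mul_zero]
  refine Submodule.eq_of_le_of_finrank_eq h1 ?_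
  have h2 := LinearMap.finrank_range_of_inj (f := A.toLinearMap) hA
  have h3 := (Submodule.span ℝ (Set.range ![p, q])).finrank_add_finrank_orthogonal
  have h4 := finrank_span_eq_card hpq.linearIndependent
  rw [h2]
  simp only [finrank_euclideanSpace_fin, Fintype.card_fin] at *
  omega

/-- The component of `w` orthogonal to `p, q` lies in the range of `A`; being also orthogonal to
that range, it vanishes. -/
theorem eq_of_orthogonal_range (hn : 2 ≤ n) {p q : EuclideanSpace ℝ (Fin (n + 1))}
    (hpq : Orthonormal ℝ ![p, q])
    (A : EuclideanSpace ℝ (Fin (n - 1)) →L[ℝ] EuclideanSpace ℝ (Fin (n + 1)))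
    (hA : Function.Injective A) (hp : ∀ v, inner ℝ (A v) p = 0) (hq : ∀ v, inner ℝ (A v) q = 0)
    {w : EuclideanSpace ℝ (Fin (n + 1))} (hw : ∀ v, inner ℝ (A v) w = 0) :
    w = inner ℝ w p • p + inner ℝ w q • q := by
  have hpp : inner ℝ p p = (1 : ℝ) := by
    rw [real_inner_self_eq_norm_sq]; have := hpq.1 0; simp_all
  have hqq : inner ℝ q q = (1 : ℝ) := by
    rw [real_inner_self_eq_norm_sq]; have := hpq.1 1; simp_all
  have hpq0 : inner ℝ p q = (0 : ℝ) := by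
    have := hpq.2 (show (0 : Fin 2) ≠ 1 by decide); simpa using this
  have hqp0 : inner ℝ q p = (0 : ℝ) := by rw [real_inner_comm]; exact hpq0
  set d := w - (inner ℝ w p • p + inner ℝ w q • q) with hd
  have hdp : inner ℝ p d = 0 := by
    rw [hd, inner_sub_right, inner_add_right, inner_smul_right, inner_smul_right, hpp, hpq0,
      real_inner_comm]; ring
  have hdq : inner ℝ q d = 0 := by
    rw [hd, inner_sub_right, inner_add_right, inner_smul_right, inner_smul_right, hqq, hqp0,
      real_inner_comm]; ring
  have hmem : d ∈ LinearMap.range A.toLinearMap := by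
    rw [range_eq_orthogonal_pair hn hpq A hA hp hq, Submodule.mem_orthogonal]
    intro u hu
    induction hu using Submodule.span_induction with
    | mem u hu =>
      obtain ⟨i, rfl⟩ := hu
      fin_cases i
      · exact hdp
      · exact hdq
    | zero => simp
    | add a b _ _ ha hb => rw [inner_add_left, ha, hb, add_zero]
    | smul r a _ ha => rw [inner_smul_left, ha, mul_zero]
  obtain ⟨v, hv⟩ := hmem
  have hv' : A v = d := hv
  have : inner ℝ d d = (0 : ℝ) := by
    have h0 : inner ℝ d d = inner ℝ (w - (inner ℝ w p • p + inner ℝ w q • q)) d := by rw [← hd]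
    rw [h0, inner_sub_left, inner_add_left, inner_smul_left, inner_smul_left, hdp, hdq, real_inner_comm,
      ← hv', hw v]
    simp
  exact sub_eq_zero.1 (inner_self_eq_zero.1 this)

end Frame

/-! ### Planar spherical leaves are open in a round sphere. -/

section RoundSphere

variable {n : ℕ} {M₀ : Type*} [TopologicalSpace M₀] [Nonempty M₀]
  [ChartedSpace (EuclideanSpace ℝ (Fin (n - 1))) M₀]

/-- An immersed `(n-1)`-manifold contained in a sphere and in an affine hyperplane is an open piece
of a round `(n-1)`-sphere. -/
theorem isOpenPieceOfRoundSphere_range (hn : 2 ≤ n) {F : M₀ → EuclideanSpace ℝ (Fin (n + 1))}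
    (hF : ∀ x, ∃ A : EuclideanSpace ℝ (Fin (n - 1)) →L[ℝ] EuclideanSpace ℝ (Fin (n + 1)),
      Function.Injective A ∧
        HasStrictFDerivAt (fun u => F ((chartAt (EuclideanSpace ℝ (Fin (n - 1))) x).symm u)) A
          (chartAt (EuclideanSpace ℝ (Fin (n - 1))) x x))
    {c h : EuclideanSpace ℝ (Fin (n + 1))} (hh : h ≠ 0) {r : ℝ}
    (hr : ∀ x, dist (F x) c = r) (hk : ∀ x, inner ℝ h (F x - c) = 0) :
    IsOpenPieceOfRoundSphere (Set.range F) := by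
  have hr2 : ∀ x, inner ℝ (F x - c) (F x - c) = r ^ 2 := by
    intro x; rw [real_inner_self_eq_norm_sq, ← dist_eq_norm, hr]
  have hr0 : 0 ≤ r := by
    rw [← hr (Classical.arbitrary M₀)]; exact dist_nonneg
  -- Radius zero would make `F` constant, against injectivity of its differential on a space of
  -- dimension `n - 1 ≥ 1`.
  have hrpos : 0 < r := by
    refine lt_of_le_of_ne hr0 fun h0 => ?_
    obtain ⟨A, hA, hA'⟩ := hF (Classical.arbitrary M₀)
    have hcst : F = fun _ => c := funext fun x => by rw [← dist_eq_zero, hr, h0]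
    have hA0 : A = 0 := hA'.hasFDerivAt.unique (by rw [hcst]; exact hasFDerivAt_const _ _)
    have : (EuclideanSpace.single (⟨0, by omega⟩ : Fin (n - 1)) (1 : ℝ)) = 0 :=
      hA (by rw [hA0]; simp)
    simp at this
  set S : Set (EuclideanSpace ℝ (Fin (n + 1))) := {y | dist y c = r ∧ inner ℝ h (y - c) = 0}
    with hS
  have hmem : ∀ x, F x ∈ S := fun x => ⟨hr x, hk x⟩
  -- This says that the range of `F` is open in `S`.
  have hnhds : ∀ x, Set.range F ∪ Sᶜ ∈ nhds (F x) := by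
    intro x
    obtain ⟨A, hA, hA'⟩ := hF x
    set e := chartAt (EuclideanSpace ℝ (Fin (n - 1))) x with he
    have hex : e.symm (e x) = x := e.left_inv (mem_chart_source _ x)
    have hort : ∀ v, inner ℝ (A v) (F x - c) = 0 := by
      intro v
      have h1 := (hA'.hasFDerivAt.sub_const c).inner ℝ (hA'.hasFDerivAt.sub_const c)
      have h2 := h1.unique ((hasFDerivAt_const (r ^ 2) (e x)).congr_of_eventuallyEq
        (.of_forall fun u => hr2 _))
      have h3 := DFunLike.congr_fun h2 v
      simp [hex, real_inner_comm] at h3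
      rw [real_inner_comm]
      linarith
    have horth : ∀ v, inner ℝ (A v) h = 0 := by
      intro v
      have h1 := (hasFDerivAt_const h (e x)).inner ℝ (hA'.hasFDerivAt.sub_const c)
      have h2 := h1.unique ((hasFDerivAt_const (0 : ℝ) (e x)).congr_of_eventuallyEq
        (.of_forall fun u => hk _))
      have h3 := DFunLike.congr_fun h2 v
      simp at h3
      rw [real_inner_comm]
      linarith
    -- Two transverse parameters, radial scaling about `c` and translation along `h`, extend `F` to
    -- a map between spaces of equal dimension, which is open at the base point; `G` meets `S` near
    -- there only when both vanish.
    let G : EuclideanSpace ℝ (Fin (n - 1)) × ℝ × ℝ → EuclideanSpace ℝ (Fin (n + 1)) :=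
      fun q => c + ((1 + q.2.1) • (F (e.symm q.1) - c) + q.2.2 • h)
    let L1 := ContinuousLinearMap.fst ℝ (EuclideanSpace ℝ (Fin (n - 1))) (ℝ × ℝ)
    let L2 := (ContinuousLinearMap.fst ℝ ℝ ℝ).comp
      (ContinuousLinearMap.snd ℝ (EuclideanSpace ℝ (Fin (n - 1))) (ℝ × ℝ))
    let L3 := (ContinuousLinearMap.snd ℝ ℝ ℝ).comp
      (ContinuousLinearMap.snd ℝ (EuclideanSpace ℝ (Fin (n - 1))) (ℝ × ℝ))
    let G' := A.comp L1 + (L2.smulRight (F x - c) + L3.smulRight h)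
    have hG : HasStrictFDerivAt G G' (e x, 0, 0) := by
      have h1 : HasStrictFDerivAt (fun q : EuclideanSpace ℝ (Fin (n - 1)) × ℝ × ℝ =>
          F (e.symm q.1) - c) (A.comp L1) (e x, 0, 0) :=
        (HasStrictFDerivAt.comp (f := fun q : EuclideanSpace ℝ (Fin (n - 1)) × ℝ × ℝ => q.1)
          (e x, 0, 0) hA' L1.hasStrictFDerivAt).sub_const c
      have h2 : HasStrictFDerivAt (fun q : EuclideanSpace ℝ (Fin (n - 1)) × ℝ × ℝ =>
          1 + q.2.1) L2 (e x, 0, 0) := L2.hasStrictFDerivAt.const_add 1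
      have h3 : HasStrictFDerivAt (fun q : EuclideanSpace ℝ (Fin (n - 1)) × ℝ × ℝ =>
          q.2.2 • h) (L3.smulRight h) (e x, 0, 0) := (L3.smulRight h).hasStrictFDerivAt
      refine (((h2.smul h1).add h3).const_add c).congr_fderiv ?_
      ext q <;> simp [G', hex, add_assoc]
    have hinj : Function.Injective G' := by
      rw [injective_iff_map_eq_zero]
      rintro ⟨v, a, b⟩ hq
      have hq' : A v + (a • (F x - c) + b • h) = 0 := hq
      have ha : a = 0 := by
        have := congrArg (fun y => inner ℝ y (F x - c)) hq'
        simp only [inner_add_left, inner_smul_left, hort, hk, hr2, inner_zero_left] at this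
        have h0 : r ^ 2 ≠ 0 := by positivity
        simpa [h0, hrpos.ne'] using this
      have hb : b = 0 := by
        have := congrArg (fun y => inner ℝ y h) hq'
        simp only [inner_add_left, inner_smul_left, horth, inner_zero_left, ha] at this
        simpa [hh] using this
      have hv : v = 0 := hA (by rw [map_zero]; simpa [ha, hb] using hq')
      simp [hv, ha, hb]
    have hsurj : LinearMap.range G'.toLinearMap = ⊤ := by
      apply LinearMap.range_eq_top.2
      refine (LinearMap.injective_iff_surjective_of_finrank_eq_finrank ?_).1 hinj
      simp
      omega
    have hmap := hG.map_nhds_eq_of_surj hsurj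
    have hGx : G (e x, 0, 0) = F x := by simp [G, hex]
    rw [hGx] at hmap
    rw [← hmap, Filter.mem_map]
    -- Positivity of `1 + q.2.1` excludes the antipodal solution of `|1 + q.2.1| r = r`.
    have hev : ∀ᶠ q : EuclideanSpace ℝ (Fin (n - 1)) × ℝ × ℝ in nhds (e x, 0, 0), -1 < q.2.1 :=
      (isOpen_lt continuous_const (by fun_prop)).mem_nhds (by simp)
    filter_upwards [hev] with q hq
    by_cases hqS : G q ∈ S
    · left
      obtain ⟨h1, h2⟩ := hqS
      have h3 : q.2.2 = 0 := by
        simp only [G, add_sub_cancel_left, inner_add_right, inner_smul_right, hk] at h2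
        simpa [hh] using h2
      have h4 : q.2.1 = 0 := by
        simp only [G, h3, zero_smul, add_zero, dist_eq_norm, add_sub_cancel_left, norm_smul] at h1
        rw [← dist_eq_norm, hr, Real.norm_eq_abs, abs_of_pos (by linarith)] at h1
        have : q.2.1 * r = 0 := by linarith
        simpa [hrpos.ne'] using this
      exact ⟨e.symm q.1, by simp [G, h3, h4]⟩
    · right; exact hqS
  refine ⟨S, interior (Set.range F ∪ Sᶜ), ⟨c, h, r, hh, hrpos, rfl⟩, isOpen_interior, ?_⟩
  apply Set.Subset.antisymm
  · rintro _ ⟨x, rfl⟩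
    exact ⟨hmem x, mem_interior_iff_mem_nhds.2 (hnhds x)⟩
  · rintro y ⟨h1, h2⟩
    rcases interior_subset h2 with h3 | h3
    · exact h3
    · exact absurd h1 h3

end RoundSphere

/-! ### The frame `N, ν` and the tangent spaces of the leaves. -/

section Leaves

variable {n : ℕ} {M₀ : Type*} [TopologicalSpace M₀]
  [ChartedSpace (EuclideanSpace ℝ (Fin (n - 1))) M₀]

/-- The unit vector field `ρ⁻¹ N_* ∂ₛ`. -/
def unitField (N : M₀ × ℝ → Metric.sphere (0 : EuclideanSpace ℝ (Fin (n + 1))) 1) (ρ : M₀ × ℝ → ℝ)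
    (x : M₀) (s : ℝ) : EuclideanSpace ℝ (Fin (n + 1)) :=
  (ρ (x, s))⁻¹ • pushforward (ambient N) (x, s) (0, 1)

theorem leafDeriv_injective {f : M₀ × ℝ → EuclideanSpace ℝ (Fin (n + 1))} {x : M₀} {s : ℝ}
    (h : Function.Injective (pushforward f (x, s))) : Function.Injective (leafDeriv f x s) := by
  intro u v huv
  exact congrArg Prod.fst (h huv)

theorem ContMDiffOn.contMDiffAt_leaf {J : Set ℝ} (hJo : IsOpen J)
    {H V B : Type*} [TopologicalSpace H] [TopologicalSpace B] [ChartedSpace H B]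
    [NormedAddCommGroup V] [NormedSpace ℝ V] {I : ModelWithCorners ℝ V H} {F : M₀ × ℝ → B}
    (hF : ContMDiffOn (prodModel n) I ∞ F (Set.univ ×ˢ J)) (x : M₀) {s : ℝ} (hs : s ∈ J) :
    ContMDiffAt (prodModel n) I ∞ F (x, s) :=
  hF.contMDiffAt ((isOpen_univ.prod hJo).mem_nhds ⟨trivial, hs⟩)

theorem inner_leafDeriv_sub_eq_zero {F : M₀ × ℝ → EuclideanSpace ℝ (Fin (n + 1))} {x : M₀} {s : ℝ}
    (hF : ContMDiffAt (prodModel n) 𝓘(ℝ, EuclideanSpace ℝ (Fin (n + 1))) ∞ F (x, s))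
    {c : EuclideanSpace ℝ (Fin (n + 1))} {r : ℝ} (hr : ∀ y, dist (F (y, s)) c = r)
    (v : EuclideanSpace ℝ (Fin (n - 1))) : inner ℝ (leafDeriv F x s v) (F (x, s) - c) = 0 := by
  set e := chartAt (EuclideanSpace ℝ (Fin (n - 1))) x with he
  have hex : e.symm (e x) = x := e.left_inv (mem_chart_source _ x)
  have h0 := (hasStrictFDerivAt_leaf hF).hasFDerivAt.sub_const c
  have h1 := h0.inner ℝ h0
  have h2 := h1.unique ((hasFDerivAt_const (r ^ 2) (e x)).congr_of_eventuallyEq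
    (.of_forall fun u => by
      dsimp only
      rw [real_inner_self_eq_norm_sq, ← dist_eq_norm, hr]))
  have h3 := DFunLike.congr_fun h2 v
  simp only [ContinuousLinearMap.comp_apply, ContinuousLinearMap.prod_apply, fderivInnerCLM_apply,
    zero_apply, ← he, hex] at h3
  have h4 := real_inner_comm (F (x, s) - c) (leafDeriv F x s v)
  linarith

variable {J : Set ℝ} {N : M₀ × ℝ → Metric.sphere (0 : EuclideanSpace ℝ (Fin (n + 1))) 1}
  {ρ : M₀ × ℝ → ℝ} {f : M₀ × ℝ → EuclideanSpace ℝ (Fin (n + 1))}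

omit [TopologicalSpace M₀] [ChartedSpace (EuclideanSpace ℝ (Fin (n - 1))) M₀] in
theorem norm_ambient (p : M₀ × ℝ) : ‖ambient N p‖ = 1 := by
  simp [ambient]

omit [TopologicalSpace M₀] [ChartedSpace (EuclideanSpace ℝ (Fin (n - 1))) M₀] in
theorem inner_ambient_self (p : M₀ × ℝ) : inner ℝ (ambient N p) (ambient N p) = (1 : ℝ) := by
  rw [real_inner_self_eq_norm_sq, norm_ambient, one_pow]

theorem inner_leafDeriv_ambient {x : M₀} {s : ℝ}
    (h : ContMDiffAt (prodModel n) (𝓡 n) ∞ N (x, s)) (v : EuclideanSpace ℝ (Fin (n - 1))) :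
    inner ℝ (leafDeriv (ambient N) x s v) (ambient N (x, s)) = 0 := by
  have := inner_leafDeriv_sub_eq_zero (contMDiffAt_ambient h) (c := 0) (r := 1)
    (fun y => by rw [dist_zero_right, norm_ambient]) v
  rwa [sub_zero] at this

theorem inner_line_ambient {x : M₀} {s : ℝ} (h : ContMDiffAt (prodModel n) (𝓡 n) ∞ N (x, s)) :
    inner ℝ (pushforward (ambient N) (x, s) (0, 1)) (ambient N (x, s)) = 0 := by
  have h0 := hasDerivAt_line (contMDiffAt_ambient h)
  have h1 := (h0.inner ℝ h0).unique ((hasDerivAt_const s (1 : ℝ)).congr_of_eventuallyEq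
    (.of_forall fun u => inner_ambient_self _))
  rw [real_inner_comm] at h1
  linarith

theorem HasSplitMetric.norm_sq (hρ : HasSplitMetric J N ρ) (x : M₀) {s : ℝ} (hs : s ∈ J) :
    inner ℝ (pushforward (ambient N) (x, s) (0, 1)) (pushforward (ambient N) (x, s) (0, 1)) =
      ρ (x, s) ^ 2 := by
  have h := hρ.metric_eq x s hs 0 0 1 1
  have h0 : pushforward (ambient N) (x, s) (0, 0) = 0 := map_zero _
  simp only [inducedMetric, h0, inner_zero_left] at h
  linarith

theorem HasSplitMetric.ne_zero (hρ : HasSplitMetric J N ρ)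
    (hN : IsLocalDiffeomorphOn (prodModel n) (𝓡 n) ∞ N (Set.univ ×ˢ J)) (x : M₀) {s : ℝ}
    (hs : s ∈ J) : ρ (x, s) ≠ 0 := by
  intro h0
  have h := hρ.norm_sq x hs
  rw [h0, zero_pow two_ne_zero, inner_self_eq_zero] at h
  have h1 := injective_pushforward_ambient (hN ⟨(x, s), trivial, hs⟩)
    (h.trans (map_zero (pushforward (ambient N) (x, s))).symm)
  exact one_ne_zero (congrArg Prod.snd h1)

theorem HasSplitMetric.inner_leafDeriv (hρ : HasSplitMetric J N ρ) (x : M₀) {s : ℝ} (hs : s ∈ J)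
    (v : EuclideanSpace ℝ (Fin (n - 1))) :
    inner ℝ (leafDeriv (ambient N) x s v) (unitField N ρ x s) = 0 := by
  have h := hρ.metric_eq x s hs v 0 0 1
  have h0 : pushforward (ambient N) (x, s) (0, 0) = 0 := map_zero _
  simp only [inducedMetric, h0, inner_zero_right] at h
  rw [unitField, inner_smul_right]
  change _ * inner ℝ (pushforward (ambient N) (x, s) (v, 0)) _ = 0
  rw [h]
  ring

theorem orthonormal_ambient_unitField (hρ : HasSplitMetric J N ρ)
    (hN : IsLocalDiffeomorphOn (prodModel n) (𝓡 n) ∞ N (Set.univ ×ˢ J)) (x : M₀) {s : ℝ}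
    (hs : s ∈ J) : Orthonormal ℝ ![ambient N (x, s), unitField N ρ x s] := by
  have hr := hρ.ne_zero hN x hs
  rw [orthonormal_iff_ite]
  have h1 := inner_line_ambient (hN ⟨(x, s), trivial, hs⟩).contMDiffAt
  have h2 := hρ.norm_sq x hs
  have h3 := h1
  rw [real_inner_comm] at h3
  intro i j
  fin_cases i <;> fin_cases j
  · simp [norm_ambient]
  · simp [unitField, inner_smul_right, h3]
  · simp [unitField, inner_smul_left, h1]
  · have : inner ℝ (unitField N ρ x s) (unitField N ρ x s) = (1 : ℝ) := by
      rw [unitField, inner_smul_left, inner_smul_right, h2]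
      simp
      field_simp
    simpa only [Fin.mk_one, Matrix.cons_val_one, Matrix.cons_val_fin_one, if_true] using this

/-- This is the vanishing of the second fundamental form on `(∂ₛ, X)`, rescaled by `ρ⁻¹`. -/
theorem IsEnneperType.inner_leafDeriv_unitField (hf : IsEnneperType J f N) (x : M₀) {s : ℝ}
    (hs : s ∈ J) (v : EuclideanSpace ℝ (Fin (n - 1))) :
    inner ℝ (leafDeriv f x s v) (unitField N ρ x s) = 0 := by
  have h := (hf.adapted x s hs v 1).2
  rw [secondFundamentalForm, inner_neg_left, neg_eq_zero, real_inner_comm] at h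
  rw [unitField, inner_smul_right]
  change _ * inner ℝ (pushforward f (x, s) (v, 0)) _ = 0
  rw [h, mul_zero]

theorem IsEnneperType.inner_leafDeriv_ambient (hf : IsEnneperType J f N) (x : M₀) {s : ℝ}
    (hs : s ∈ J) (v : EuclideanSpace ℝ (Fin (n - 1))) :
    inner ℝ (leafDeriv f x s v) (ambient N (x, s)) = 0 :=
  hf.gaussMap.normal x s hs (v, 0)

/-- Both ranges are the orthogonal complement of `N, ν`, which depends only on `N` and `ρ`. -/
theorem IsEnneperType.range_leafDeriv (hn : 2 ≤ n) (hf : IsEnneperType J f N)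
    (hρ : HasSplitMetric J N ρ)
    (hN : IsLocalDiffeomorphOn (prodModel n) (𝓡 n) ∞ N (Set.univ ×ˢ J)) (x : M₀) {s : ℝ}
    (hs : s ∈ J) : LinearMap.range (leafDeriv f x s).toLinearMap =
      LinearMap.range (leafDeriv (ambient N) x s).toLinearMap := by
  have h := orthonormal_ambient_unitField hρ hN x hs
  rw [range_eq_orthogonal_pair hn h _ (leafDeriv_injective (hf.hypersurface.immersion x s hs))
    (hf.inner_leafDeriv_ambient x hs) (hf.inner_leafDeriv_unitField x hs),
    range_eq_orthogonal_pair hn h _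
    (leafDeriv_injective (injective_pushforward_ambient (hN ⟨(x, s), trivial, hs⟩)))
    (_root_.inner_leafDeriv_ambient (hN ⟨(x, s), trivial, hs⟩).contMDiffAt)
    (hρ.inner_leafDeriv x hs)]

/-- If the derivative of `⟨F - c, G⟩` along a leaf vanishes, then `⟨F - c, G⟩` is constant on it. -/
theorem inner_const_of_leafDeriv [ConnectedSpace M₀] [IsManifold (𝓡 (n - 1)) ∞ M₀] {s : ℝ}
    {F G : M₀ × ℝ → EuclideanSpace ℝ (Fin (n + 1))}
    (hF : ∀ x, ContMDiffAt (prodModel n) 𝓘(ℝ, EuclideanSpace ℝ (Fin (n + 1))) ∞ F (x, s))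
    (hG : ∀ x, ContMDiffAt (prodModel n) 𝓘(ℝ, EuclideanSpace ℝ (Fin (n + 1))) ∞ G (x, s))
    (c : EuclideanSpace ℝ (Fin (n + 1)))
    (h : ∀ x v, inner ℝ (leafDeriv F x s v) (G (x, s)) +
      inner ℝ (F (x, s) - c) (leafDeriv G x s v) = 0)
    (x y : M₀) : (inner ℝ (F (x, s) - c) (G (x, s)) : ℝ) = inner ℝ (F (y, s) - c) (G (y, s)) := by
  refine eq_of_hasFDerivAt_chart_zero (n := n)
    (g := fun x => (inner ℝ (F (x, s) - c) (G (x, s)) : ℝ)) (fun x => ?_) x y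
  set e := chartAt (EuclideanSpace ℝ (Fin (n - 1))) x with he
  have hex : e.symm (e x) = x := e.left_inv (mem_chart_source _ x)
  refine (((hasStrictFDerivAt_leaf (hF x)).hasFDerivAt.sub_const c).inner ℝ
    (hasStrictFDerivAt_leaf (hG x)).hasFDerivAt).congr_fderiv ?_
  refine ContinuousLinearMap.ext fun v => ?_
  simp only [ContinuousLinearMap.comp_apply, ContinuousLinearMap.prod_apply, fderivInnerCLM_apply,
    zero_apply, ← he, hex]
  rw [add_comm]
  exact h x v

theorem leafDeriv_const (w : EuclideanSpace ℝ (Fin (n + 1))) (x : M₀) (s : ℝ)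
    (v : EuclideanSpace ℝ (Fin (n - 1))) : leafDeriv (fun _ : M₀ × ℝ => w) x s v = 0 := by
  have : pushforward (fun _ : M₀ × ℝ => w) (x, s) = 0 := mfderiv_const
  rw [leafDeriv, this]
  rfl

/-- The leaf of `F` at `s` is contained in a hyperplane orthogonal to `w`. -/
def LeafInHyperplane (F : M₀ × ℝ → EuclideanSpace ℝ (Fin (n + 1))) (s : ℝ)
    (w : EuclideanSpace ℝ (Fin (n + 1))) : Prop :=
  ∀ x y : M₀, (inner ℝ (F (x, s)) w : ℝ) = inner ℝ (F (y, s)) w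

theorem leafInHyperplane_iff [ConnectedSpace M₀] [IsManifold (𝓡 (n - 1)) ∞ M₀] {s : ℝ}
    {F : M₀ × ℝ → EuclideanSpace ℝ (Fin (n + 1))}
    (hF : ∀ x, ContMDiffAt (prodModel n) 𝓘(ℝ, EuclideanSpace ℝ (Fin (n + 1))) ∞ F (x, s))
    (w : EuclideanSpace ℝ (Fin (n + 1))) :
    LeafInHyperplane F s w ↔ ∀ x v, inner ℝ (leafDeriv F x s v) w = 0 := by
  constructor
  · intro h x v
    set e := chartAt (EuclideanSpace ℝ (Fin (n - 1))) x with he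
    have h1 := (hasStrictFDerivAt_leaf (hF x)).hasFDerivAt.inner ℝ (hasFDerivAt_const w (e x))
    have h2 := h1.unique ((hasFDerivAt_const (inner ℝ (F (x, s)) w : ℝ) (e x)).congr_of_eventuallyEq
      (.of_forall fun u => h _ _))
    have h3 := DFunLike.congr_fun h2 v
    simp only [ContinuousLinearMap.comp_apply, ContinuousLinearMap.prod_apply, fderivInnerCLM_apply,
      zero_apply, inner_zero_right, zero_add] at h3
    exact h3
  · intro h x y
    have := inner_const_of_leafDeriv hF (fun x => contMDiffAt_const (c := w)) 0
      (fun x v => by rw [leafDeriv_const, inner_zero_right, add_zero]; exact h x v) x y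
    simpa using this

theorem IsEnneperType.contMDiffAt (hJo : IsOpen J) (hf : IsEnneperType J f N) (x : M₀) {s : ℝ}
    (hs : s ∈ J) :
    ContMDiffAt (prodModel n) 𝓘(ℝ, EuclideanSpace ℝ (Fin (n + 1))) ∞ f (x, s) :=
  hf.hypersurface.smooth.contMDiffAt_leaf hJo x hs

theorem IsEnneperType.leafInHyperplane_iff_ambient [ConnectedSpace M₀]
    [IsManifold (𝓡 (n - 1)) ∞ M₀] (hn : 2 ≤ n) (hJo : IsOpen J) (hf : IsEnneperType J f N)
    (hρ : HasSplitMetric J N ρ)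
    (hN : IsLocalDiffeomorphOn (prodModel n) (𝓡 n) ∞ N (Set.univ ×ˢ J)) {s : ℝ}
    (hs : s ∈ J) (w : EuclideanSpace ℝ (Fin (n + 1))) :
    LeafInHyperplane f s w ↔ LeafInHyperplane (ambient N) s w := by
  rw [leafInHyperplane_iff (fun x => hf.contMDiffAt hJo x hs),
    leafInHyperplane_iff (fun x => contMDiffAt_ambient (hN ⟨(x, s), trivial, hs⟩).contMDiffAt)]
  refine forall_congr' fun x => ?_
  have hr := hf.range_leafDeriv hn hρ hN x hs
  constructor
  · intro h v
    have : leafDeriv (ambient N) x s v ∈ LinearMap.range (leafDeriv f x s).toLinearMap := by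
      rw [hr]; exact ⟨v, rfl⟩
    obtain ⟨u, hu⟩ := this
    rw [← hu]
    exact h u
  · intro h v
    have : leafDeriv f x s v ∈ LinearMap.range (leafDeriv (ambient N) x s).toLinearMap := by
      rw [← hr]; exact ⟨v, rfl⟩
    obtain ⟨u, hu⟩ := this
    rw [← hu]
    exact h u

/-- A leaf of a hypersurface of Enneper type that lies in a hyperplane is an open piece of a round
sphere. -/
theorem IsEnneperType.isOpenPiece_of_leafInHyperplane [Nonempty M₀] (hn : 2 ≤ n) (hJo : IsOpen J)
    (hf : IsEnneperType J f N) {s : ℝ} (hs : s ∈ J) {w : EuclideanSpace ℝ (Fin (n + 1))}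
    (hw : w ≠ 0) (h : LeafInHyperplane f s w) :
    IsOpenPieceOfRoundSphere (Set.range fun x : M₀ => f (x, s)) := by
  obtain ⟨c₀, r₀, -, hc⟩ := hf.spherical s hs
  set x₀ := Classical.arbitrary M₀
  have hww : (inner ℝ w w : ℝ) ≠ 0 := inner_self_ne_zero.2 hw
  -- The new centre `c₀ + t • w` is the orthogonal projection of `c₀` to the hyperplane of the leaf;
  -- Pythagoras then gives constant distance to it.
  set t : ℝ := inner ℝ w (f (x₀, s) - c₀) / inner ℝ w w with ht
  have hk : ∀ x, inner ℝ w (f (x, s) - (c₀ + t • w)) = 0 := by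
    intro x
    have h1 := h x x₀
    rw [real_inner_comm, real_inner_comm w] at h1
    rw [← sub_sub, inner_sub_right, inner_smul_right, ht, div_mul_cancel₀ _ hww, inner_sub_right,
      inner_sub_right, h1, sub_self]
  have hd : ∀ x, inner ℝ (f (x, s) - (c₀ + t • w)) (f (x, s) - (c₀ + t • w)) =
      r₀ ^ 2 - t ^ 2 * inner ℝ w w := by
    intro x
    have h2 : inner ℝ (f (x, s) - c₀) (f (x, s) - c₀) = r₀ ^ 2 := by
      rw [real_inner_self_eq_norm_sq, ← dist_eq_norm, Metric.mem_sphere.1 (hc x)]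
    have h3 : f (x, s) - c₀ = (f (x, s) - (c₀ + t • w)) + t • w := by abel
    rw [h3, inner_add_add_self, inner_smul_right, inner_smul_left, inner_smul_left,
      inner_smul_right, real_inner_comm, hk x] at h2
    have h5 := (real_inner_comm w (f (x, s) - (c₀ + t • w))).trans (hk x)
    simp only [conj_trivial, h5] at h2
    linarith
  refine isOpenPieceOfRoundSphere_range hn (fun x => ⟨leafDeriv f x s,
    leafDeriv_injective (hf.hypersurface.immersion x s hs),
    hasStrictFDerivAt_leaf (hf.contMDiffAt hJo x hs)⟩) hw (c := c₀ + t • w)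
    (r := dist (f (x₀, s)) (c₀ + t • w)) (fun x => ?_) hk
  have h4 := (hd x).trans (hd x₀).symm
  rw [real_inner_self_eq_norm_sq, real_inner_self_eq_norm_sq, ← dist_eq_norm, ← dist_eq_norm] at h4
  exact (pow_left_inj₀ dist_nonneg dist_nonneg two_ne_zero).1 h4

end Leaves

/-! ### Smooth dependence of the centre of a sphere on its points. -/

section Centers

variable {V : Type*} [NormedAddCommGroup V] [InnerProductSpace ℝ V] [FiniteDimensional ℝ V]

/-- The centre of a sphere depends smoothly on points of the sphere that affinely span the
space. -/
theorem contDiffAt_center {ι : Type*} [Fintype ι] {k : WithTop ℕ∞} {p : ι → ℝ → V} {p₀ c : ℝ → V}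
    {s₀ : ℝ} (hp : ∀ i, ContDiffAt ℝ k (p i) s₀) (hp₀ : ContDiffAt ℝ k p₀ s₀)
    (hspan : Submodule.span ℝ (Set.range fun i => p i s₀ - p₀ s₀) = ⊤)
    (hc : ∀ᶠ s in nhds s₀, ∀ i, dist (p i s) (c s) = dist (p₀ s) (c s)) : ContDiffAt ℝ k c s₀ := by
  have : CompleteSpace V := FiniteDimensional.complete ℝ V
  let v : ι → ℝ → V := fun i s => p i s - p₀ s
  have hv : ∀ i, ContDiffAt ℝ k (v i) s₀ := fun i => (hp i).sub hp₀
  -- Equidistance reads `⟨v i, c⟩ = (|p i|² - |p₀|²) / 2`. Multiplying by `v i` and summing gives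
  -- the square system `T c = d`, invertible at `s₀` since `⟨T w, w⟩ = ∑ ⟨v i, w⟩²` and the `v i`
  -- span.
  let T : ℝ → V →L[ℝ] V := fun s => ∑ i, (innerSL ℝ (v i s)).smulRight (v i s)
  let d : ℝ → V := fun s =>
    ∑ i, ((inner ℝ (p i s) (p i s) - inner ℝ (p₀ s) (p₀ s)) / 2 : ℝ) • v i s
  have hT : ContDiffAt ℝ k T s₀ :=
    ContDiffAt.sum fun i _ => ((innerSL ℝ).contDiff.contDiffAt.comp s₀ (hv i)).smulRight (hv i)
  have hd : ContDiffAt ℝ k d s₀ :=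
    ContDiffAt.sum fun i _ => ((((hp i).inner ℝ (hp i)).sub (hp₀.inner ℝ hp₀)).div_const 2).smul
      (hv i)
  have hTc : ∀ᶠ s in nhds s₀, T s (c s) = d s := by
    filter_upwards [hc] with s hs
    simp only [T, d, sum_apply, ContinuousLinearMap.smulRight_apply, innerSL_apply_apply]
    refine Finset.sum_congr rfl fun i _ => ?_
    congr 1
    have h1 := congrArg (· ^ 2) (hs i)
    simp only [dist_eq_norm, ← real_inner_self_eq_norm_sq, inner_sub_sub_self] at h1
    have h2 := real_inner_comm (p i s) (c s)
    have h3 := real_inner_comm (p₀ s) (c s)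
    rw [inner_sub_left]
    linarith
  have hinj : Function.Injective (T s₀) := by
    rw [injective_iff_map_eq_zero]
    intro w hw
    have h1 : ∑ i, (inner ℝ (v i s₀) w : ℝ) ^ 2 = 0 := by
      have := congrArg (fun y => (inner ℝ y w : ℝ)) hw
      simp only [T, sum_apply, ContinuousLinearMap.smulRight_apply, innerSL_apply_apply, sum_inner,
        inner_smul_left, inner_zero_left, conj_trivial] at this
      simpa [sq] using this
    have h2 : ∀ i, (inner ℝ (v i s₀) w : ℝ) = 0 := fun i => by
      have := (Finset.sum_eq_zero_iff_of_nonneg fun i _ => sq_nonneg _).1 h1 i (Finset.mem_univ i)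
      exact pow_eq_zero_iff two_ne_zero |>.1 this
    have h3 : w ∈ (Submodule.span ℝ (Set.range fun i => p i s₀ - p₀ s₀))ᗮ := by
      rw [Submodule.mem_orthogonal]
      intro u hu
      induction hu using Submodule.span_induction with
      | mem u hu =>
        obtain ⟨i, rfl⟩ := hu
        exact h2 i
      | zero => simp
      | add a b _ _ ha hb => rw [inner_add_left, ha, hb, add_zero]
      | smul r a _ ha => rw [inner_smul_left, ha, mul_zero]
    rw [hspan, Submodule.top_orthogonal_eq_bot] at h3
    exact h3
  let e : V ≃L[ℝ] V :=
    (LinearEquiv.ofInjectiveEndo (T s₀).toLinearMap hinj).toContinuousLinearEquiv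
  have he : (e : V →L[ℝ] V) = T s₀ := by
    ext w
    rfl
  have hinv : ContDiffAt ℝ k (fun s => ContinuousLinearMap.inverse (T s) (d s)) s₀ := by
    have h1 : ContDiffAt ℝ k (ContinuousLinearMap.inverse : (V →L[ℝ] V) → V →L[ℝ] V) (T s₀) := by
      rw [← he]; exact contDiffAt_map_inverse e
    exact (h1.comp s₀ hT).clm_apply hd
  refine hinv.congr_of_eventuallyEq ?_
  have h2 : ∀ᶠ s in nhds s₀, T s ∈ Set.range ((↑) : (V ≃L[ℝ] V) → V →L[ℝ] V) :=
    hT.continuousAt.eventually (by rw [← he]; exact e.nhds)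
  filter_upwards [hTc, h2] with s h3 h4
  obtain ⟨e', he'⟩ := h4
  rw [← h3, ← he', ContinuousLinearMap.inverse_equiv]
  simp

end Centers

/-! ### The decomposition `f = c + a N + b ν` and its regularity. -/

section Decomposition

variable {n : ℕ} {M₀ : Type*} [TopologicalSpace M₀] [ConnectedSpace M₀]
  [ChartedSpace (EuclideanSpace ℝ (Fin (n - 1))) M₀]
  {J : Set ℝ} {N : M₀ × ℝ → Metric.sphere (0 : EuclideanSpace ℝ (Fin (n + 1))) 1}
  {ρ : M₀ × ℝ → ℝ} {f : M₀ × ℝ → EuclideanSpace ℝ (Fin (n + 1))}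

omit [ConnectedSpace M₀] in
theorem IsEnneperType.sub_center_eq (hn : 2 ≤ n) (hJo : IsOpen J) (hf : IsEnneperType J f N)
    (hρ : HasSplitMetric J N ρ)
    (hN : IsLocalDiffeomorphOn (prodModel n) (𝓡 n) ∞ N (Set.univ ×ˢ J)) {s : ℝ} (hs : s ∈ J)
    {c : EuclideanSpace ℝ (Fin (n + 1))} {r : ℝ} (hc : ∀ x, dist (f (x, s)) c = r) (x : M₀) :
    f (x, s) - c = inner ℝ (f (x, s) - c) (ambient N (x, s)) • ambient N (x, s) +
      inner ℝ (f (x, s) - c) (unitField N ρ x s) • unitField N ρ x s :=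
  eq_of_orthogonal_range hn (orthonormal_ambient_unitField hρ hN x hs) (leafDeriv f x s)
    (leafDeriv_injective (hf.hypersurface.immersion x s hs))
    (hf.inner_leafDeriv_ambient x hs) (hf.inner_leafDeriv_unitField x hs)
    (inner_leafDeriv_sub_eq_zero (hf.contMDiffAt hJo x hs) hc)

/-- Both terms of the derivative of `⟨f - c, N⟩` along the leaf vanish: `N` is normal to `f`, and
`N_* X` is tangent to the leaf of `f`, hence orthogonal to `f - c`. -/
theorem IsEnneperType.inner_center_ambient_eq [IsManifold (𝓡 (n - 1)) ∞ M₀] (hn : 2 ≤ n)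
    (hJo : IsOpen J) (hf : IsEnneperType J f N) (hρ : HasSplitMetric J N ρ)
    (hN : IsLocalDiffeomorphOn (prodModel n) (𝓡 n) ∞ N (Set.univ ×ˢ J)) {s : ℝ} (hs : s ∈ J)
    {c : EuclideanSpace ℝ (Fin (n + 1))} {r : ℝ} (hc : ∀ x, dist (f (x, s)) c = r) (x y : M₀) :
    (inner ℝ (f (x, s) - c) (ambient N (x, s)) : ℝ) =
      inner ℝ (f (y, s) - c) (ambient N (y, s)) := by
  refine inner_const_of_leafDeriv (fun x => hf.contMDiffAt hJo x hs)
    (fun x => contMDiffAt_ambient (hN ⟨(x, s), trivial, hs⟩).contMDiffAt) c (fun x v => ?_) x y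
  rw [hf.inner_leafDeriv_ambient x hs, zero_add]
  have : leafDeriv (ambient N) x s v ∈ LinearMap.range (leafDeriv f x s).toLinearMap := by
    rw [hf.range_leafDeriv hn hρ hN x hs]; exact ⟨v, rfl⟩
  obtain ⟨u, hu⟩ := this
  rw [← hu, real_inner_comm]
  exact inner_leafDeriv_sub_eq_zero (hf.contMDiffAt hJo x hs) hc u

omit [ConnectedSpace M₀] in
theorem continuous_unitField (hJo : IsOpen J) (hρ : HasSplitMetric J N ρ)
    (hN : IsLocalDiffeomorphOn (prodModel n) (𝓡 n) ∞ N (Set.univ ×ˢ J)) {s : ℝ} (hs : s ∈ J) :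
    Continuous fun x => unitField N ρ x s := by
  have h1 : Continuous fun x => pushforward (ambient N) (x, s) (0, 1) := by
    have h2 : (fun x => pushforward (ambient N) (x, s) (0, 1)) =
        fun x => deriv (fun t => ambient N (x, t)) s := funext fun x =>
      (hasDerivAt_line (contMDiffAt_ambient (hN ⟨(x, s), trivial, hs⟩).contMDiffAt)).deriv.symm
    rw [h2]
    exact continuous_iff_continuousAt.2 fun x =>
      continuousAt_deriv_line (contMDiffAt_ambient (hN ⟨(x, s), trivial, hs⟩).contMDiffAt)
  have h3 : Continuous fun x => ρ (x, s) := continuous_iff_continuousAt.2 fun x =>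
    ContinuousAt.comp (f := fun x => (x, s)) (hρ.smooth.contMDiffAt_leaf hJo x hs).continuousAt
      (by fun_prop)
  exact (h3.inv₀ fun x => hρ.ne_zero hN x hs).smul h1

/-- The square is constant on the leaf by Pythagoras; continuity and connectedness fix the sign. -/
theorem IsEnneperType.inner_center_unitField_eq [IsManifold (𝓡 (n - 1)) ∞ M₀] (hn : 2 ≤ n)
    (hJo : IsOpen J) (hf : IsEnneperType J f N) (hρ : HasSplitMetric J N ρ)
    (hN : IsLocalDiffeomorphOn (prodModel n) (𝓡 n) ∞ N (Set.univ ×ˢ J)) {s : ℝ} (hs : s ∈ J)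
    {c : EuclideanSpace ℝ (Fin (n + 1))} {r : ℝ} (hc : ∀ x, dist (f (x, s)) c = r) (x y : M₀) :
    (inner ℝ (f (x, s) - c) (unitField N ρ x s) : ℝ) =
      inner ℝ (f (y, s) - c) (unitField N ρ y s) := by
  set b : M₀ → ℝ := fun x => inner ℝ (f (x, s) - c) (unitField N ρ x s) with hb
  have hcont : Continuous b := by
    have h1 : Continuous fun x => f (x, s) := continuous_iff_continuousAt.2 fun x =>
      ContinuousAt.comp (f := fun x => (x, s)) (hf.contMDiffAt hJo x hs).continuousAt (by fun_prop)
    exact (h1.sub continuous_const).inner (continuous_unitField hJo hρ hN hs)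
  have hsq : ∀ z, b z ^ 2 =
      r ^ 2 - (inner ℝ (f (z, s) - c) (ambient N (z, s)) : ℝ) ^ 2 := by
    intro z
    have h1 := congrArg (fun w => (inner ℝ (f (z, s) - c) w : ℝ))
      (hf.sub_center_eq hn hJo hρ hN hs hc z)
    simp only [inner_add_right, inner_smul_right] at h1
    rw [real_inner_self_eq_norm_sq, ← dist_eq_norm, hc] at h1
    simp only [hb]
    linarith
  have hsq' : ∀ z, b z ^ 2 = b y ^ 2 := fun z => by
    rw [hsq, hsq, hf.inner_center_ambient_eq hn hJo hρ hN hs hc z y]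
  by_cases h0 : b y = 0
  · have h1 := hsq' x
    rw [h0, zero_pow two_ne_zero, pow_eq_zero_iff two_ne_zero] at h1
    change b x = b y
    rw [h1, h0]
  · rcases isPreconnected_univ.eq_or_eq_neg_of_sq_eq (f := b) (g := fun _ => b y)
      hcont.continuousOn continuousOn_const (fun z _ => hsq' z) (fun _ => h0) with h1 | h1
    · exact h1 (Set.mem_univ x)
    · have h2 : b y = -b y := h1 (Set.mem_univ y)
      exact absurd (by linarith) h0

omit [ConnectedSpace M₀] in
theorem contDiffOn_unitField (hJo : IsOpen J) (hρ : HasSplitMetric J N ρ)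
    (hN : IsLocalDiffeomorphOn (prodModel n) (𝓡 n) ∞ N (Set.univ ×ˢ J)) (x : M₀) :
    ContDiffOn ℝ ∞ (fun t => unitField N ρ x t) J := by
  have h1 : ContDiffOn ℝ ∞ (fun t => ambient N (x, t)) J := fun s hs =>
    (contDiffAt_line (contMDiffAt_ambient
      (hN ⟨(x, s), trivial, hs⟩).contMDiffAt)).contDiffWithinAt
  have h2 : ContDiffOn ℝ ∞ (deriv fun t => ambient N (x, t)) J :=
    h1.deriv_of_isOpen hJo (by simp)
  have h3 : ContDiffOn ℝ ∞ (fun t => ρ (x, t)) J := fun s hs =>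
    (contDiffAt_line (hρ.smooth.contMDiffAt_leaf hJo x hs)).contDiffWithinAt
  refine ((h3.inv fun s hs => hρ.ne_zero hN x hs).smul h2).congr fun s hs => ?_
  rw [unitField, ← (hasDerivAt_line (contMDiffAt_ambient
    (hN ⟨(x, s), trivial, hs⟩).contMDiffAt)).deriv]
  rfl

omit [ConnectedSpace M₀] in
/-- The compatibility condition `⟨γ', N⟩ + α' = β ρ` follows from the parametrization. -/
theorem compat_of_param (hJo : IsOpen J) (hf : IsEnneperType J f N) (hρ : HasSplitMetric J N ρ)
    (hN : IsLocalDiffeomorphOn (prodModel n) (𝓡 n) ∞ N (Set.univ ×ˢ J))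
    {γ : ℝ → EuclideanSpace ℝ (Fin (n + 1))} {α β : ℝ → ℝ} (x : M₀) {s : ℝ} (hs : s ∈ J)
    (hγ : DifferentiableAt ℝ γ s) (hα : DifferentiableAt ℝ α s) (hβ : DifferentiableAt ℝ β s)
    (h : ∀ t ∈ J, f (x, t) = γ t + α t • ambient N (x, t) + β t • unitField N ρ x t) :
    inner ℝ (deriv γ s) (ambient N (x, s)) + deriv α s = β s * ρ (x, s) := by
  have hNs := (hN ⟨(x, s), trivial, hs⟩).contMDiffAt
  have hNd := hasDerivAt_line (contMDiffAt_ambient hNs)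
  have hνd := (((contDiffOn_unitField hJo hρ hN x).contDiffAt (hJo.mem_nhds hs)).differentiableAt
    (by simp)).hasDerivAt
  have h1 := ((hγ.hasDerivAt.add (hα.hasDerivAt.smul hNd)).add
    (hβ.hasDerivAt.smul hνd)).congr_of_eventuallyEq
      (Filter.eventually_of_mem (hJo.mem_nhds hs) h)
  have h2 := congrArg (fun w => (inner ℝ w (ambient N (x, s)) : ℝ))
    (h1.unique (hasDerivAt_line (hf.contMDiffAt hJo x hs)))
  have h3 : (inner ℝ (pushforward f (x, s) (0, 1)) (ambient N (x, s)) : ℝ) = 0 :=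
    hf.gaussMap.normal x s hs (0, 1)
  have hort : ∀ t ∈ J, (inner ℝ (unitField N ρ x t) (ambient N (x, t)) : ℝ) = 0 := fun t ht => by
    rw [unitField, inner_smul_left, inner_line_ambient (hN ⟨(x, t), trivial, ht⟩).contMDiffAt,
      mul_zero]
  -- Differentiating `⟨ν, N⟩ = 0` gives `⟨ν', N⟩ = -⟨ν, N_* ∂ₛ⟩ = -ρ`, the source of the term `β ρ`.
  have h4 := (hνd.inner ℝ hNd).unique ((hasDerivAt_const s (0 : ℝ)).congr_of_eventuallyEq
    (Filter.eventually_of_mem (hJo.mem_nhds hs) hort))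
  have h5 : (inner ℝ (unitField N ρ x s) (pushforward (ambient N) (x, s) (0, 1)) : ℝ) =
      ρ (x, s) := by
    have := hρ.ne_zero hN x hs
    rw [unitField, inner_smul_left, hρ.norm_sq x hs, conj_trivial]
    field_simp
  simp only [inner_add_left, inner_smul_left, conj_trivial, inner_line_ambient hNs, hort s hs,
    inner_ambient_self, h3] at h2
  rw [h5] at h4
  have h6 : (inner ℝ (deriv (fun t => unitField N ρ x t) s) (ambient N (x, s)) : ℝ) =
      -ρ (x, s) := by linarith
  rw [h6] at h2
  linarith

/-- A choice of centres of the leaves is smooth if no leaf lies in a hyperplane. -/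
theorem IsEnneperType.contDiffOn_center (hJo : IsOpen J) (hf : IsEnneperType J f N)
    (hplane : ∀ s ∈ J, ∀ w, LeafInHyperplane f s w → w = 0)
    {c : ℝ → EuclideanSpace ℝ (Fin (n + 1))} {r : ℝ → ℝ}
    (hc : ∀ s ∈ J, ∀ x, dist (f (x, s)) (c s) = r s) : ContDiffOn ℝ ∞ c J := by
  intro s₀ hs₀
  obtain ⟨x₀⟩ := (inferInstance : Nonempty M₀)
  set D : Set (EuclideanSpace ℝ (Fin (n + 1))) := Set.range fun x => f (x, s₀) - f (x₀, s₀) with hD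
  have hspan : Submodule.span ℝ D = ⊤ := by
    rw [← Submodule.orthogonal_eq_bot_iff, Submodule.eq_bot_iff]
    intro w hw
    refine hplane s₀ hs₀ w fun x y => ?_
    have h1 : ∀ z, (inner ℝ (f (z, s₀)) w : ℝ) = inner ℝ (f (x₀, s₀)) w := fun z => by
      have := (Submodule.mem_orthogonal _ _).1 hw _ (Submodule.subset_span ⟨z, rfl⟩)
      rw [inner_sub_left] at this
      linarith
    rw [h1 x, h1 y]
  -- Finitely many points of the leaf already affinely span the space at `s₀`; the same points of
  -- `M₀` are used for nearby `s`.
  obtain ⟨v, hvD, hv, -⟩ := Submodule.exists_fun_fin_finrank_span_eq ℝ D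
  choose z hz using hvD
  refine (contDiffAt_center (p := fun i s => f (z i, s)) (p₀ := fun s => f (x₀, s))
    (fun i => contDiffAt_line (hf.contMDiffAt hJo _ hs₀))
    (contDiffAt_line (hf.contMDiffAt hJo _ hs₀)) ?_ ?_).contDiffWithinAt
  · have hz' : (fun i => f (z i, s₀) - f (x₀, s₀)) = v := funext hz
    exact (congrArg (fun v => Submodule.span ℝ (Set.range v)) hz').trans (hv.trans hspan)
  · filter_upwards [hJo.mem_nhds hs₀] with s hs i
    rw [hc s hs, hc s hs]

end Decomposition

end

/-! ### Comparison of two hypersurfaces with the same Gauss map. -/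

theorem mainTheorem9 (n : ℕ) (hn : 2 ≤ n)
    {M₀ : Type*} [TopologicalSpace M₀] [ConnectedSpace M₀]
    [ChartedSpace (EuclideanSpace ℝ (Fin (n - 1))) M₀] [IsManifold (𝓡 (n - 1)) ∞ M₀]
    (J : Set ℝ) (hJo : IsOpen J) (hJc : J.OrdConnected)
    (f : M₀ × ℝ → EuclideanSpace ℝ (Fin (n + 1)))
    (N : M₀ × ℝ → Metric.sphere (0 : EuclideanSpace ℝ (Fin (n + 1))) 1)
    (ρ : M₀ × ℝ → ℝ)
    (γ : ℝ → EuclideanSpace ℝ (Fin (n + 1))) (α β : ℝ → ℝ)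
    (hf : IsEnneperType J f N)
    (hN : IsLocalDiffeomorphOn (prodModel n) (𝓡 n) ∞ N (Set.univ ×ˢ J))
    (hρ : HasSplitMetric J N ρ)
    (hpar : IsParametrizedBy J N ρ f γ α β)
    (hγ : ∀ s ∈ J, deriv γ s ≠ 0)
    (hleaf : ¬ ∃ s ∈ J, IsOpenPieceOfRoundSphere (Set.range fun x : M₀ => f (x, s)))
    (f' : M₀ × ℝ → EuclideanSpace ℝ (Fin (n + 1)))
    (hf' : IsEnneperType J f' N) :
    ∃ (γ' : ℝ → EuclideanSpace ℝ (Fin (n + 1))) (α' β' l : ℝ → ℝ),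
      IsParametrizedBy J N ρ f' γ' α' β' ∧
      ContDiffOn ℝ ∞ l J ∧
      ∀ s ∈ J, β' s = l s * β s ∧ deriv α' s = l s * deriv α s ∧
        deriv γ' s = l s • deriv γ s := by
  obtain ⟨x₀⟩ := (inferInstance : Nonempty M₀)
  have hplaneN : ∀ s ∈ J, ∀ w, LeafInHyperplane (ambient N) s w → w = 0 := by
    intro s hs w hw
    by_contra hw0
    exact hleaf ⟨s, hs, hf.isOpenPiece_of_leafInHyperplane hn hJo hs hw0
      ((hf.leafInHyperplane_iff_ambient hn hJo hρ hN hs w).2 hw)⟩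
  have hplane' : ∀ s ∈ J, ∀ w, LeafInHyperplane f' s w → w = 0 := fun s hs w hw =>
    hplaneN s hs w ((hf'.leafInHyperplane_iff_ambient hn hJo hρ hN hs w).1 hw)
  have hsph : ∀ s, ∃ (c : EuclideanSpace ℝ (Fin (n + 1))) (r : ℝ),
      s ∈ J → ∀ x : M₀, dist (f' (x, s)) c = r := by
    intro s
    by_cases hs : s ∈ J
    · obtain ⟨c, r, -, h⟩ := hf'.spherical s hs
      exact ⟨c, r, fun _ => h⟩
    · exact ⟨0, 0, fun h => absurd h hs⟩
  choose c r hc using hsph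
  -- The coefficients do not depend on the point of the leaf, so they are read off at `x₀`, which
  -- makes their smoothness in `s` immediate.
  set a : ℝ → ℝ := fun s => inner ℝ (f' (x₀, s) - c s) (ambient N (x₀, s)) with ha
  set b : ℝ → ℝ := fun s => inner ℝ (f' (x₀, s) - c s) (unitField N ρ x₀ s) with hb
  have hcs : ContDiffOn ℝ ∞ c J := hf'.contDiffOn_center hJo hplane' hc
  have hfs : ContDiffOn ℝ ∞ (fun s => f' (x₀, s)) J := fun s hs =>
    (contDiffAt_line (hf'.contMDiffAt hJo x₀ hs)).contDiffWithinAt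
  have hNs : ContDiffOn ℝ ∞ (fun s => ambient N (x₀, s)) J := fun s hs =>
    (contDiffAt_line (contMDiffAt_ambient
      (hN ⟨(x₀, s), trivial, hs⟩).contMDiffAt)).contDiffWithinAt
  have has : ContDiffOn ℝ ∞ a J := (hfs.sub hcs).inner ℝ hNs
  have hbs : ContDiffOn ℝ ∞ b J := (hfs.sub hcs).inner ℝ (contDiffOn_unitField hJo hρ hN x₀)
  have hparam : ∀ x : M₀, ∀ s ∈ J,
      f' (x, s) = c s + a s • ambient N (x, s) + b s • unitField N ρ x s := by
    intro x s hs
    have h := hf'.sub_center_eq hn hJo hρ hN hs (hc s hs) x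
    rw [hf'.inner_center_ambient_eq hn hJo hρ hN hs (hc s hs) x x₀,
      hf'.inner_center_unitField_eq hn hJo hρ hN hs (hc s hs) x x₀] at h
    rw [add_assoc, ← h, add_sub_cancel]
  have hdiff : ∀ {E : Type} [NormedAddCommGroup E] [NormedSpace ℝ E] {g : ℝ → E},
      ContDiffOn ℝ ∞ g J → ∀ s ∈ J, DifferentiableAt ℝ g s := fun hg s hs =>
    (hg.contDiffAt (hJo.mem_nhds hs)).differentiableAt (by simp)
  have hcompat : ∀ x : M₀, ∀ s ∈ J,
      inner ℝ (deriv c s) (ambient N (x, s)) + deriv a s = b s * ρ (x, s) := fun x s hs =>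
    compat_of_param hJo hf' hρ hN x hs (hdiff hcs s hs) (hdiff has s hs) (hdiff hbs s hs)
      (hparam x)
  have hβ : ∀ s ∈ J, β s ≠ 0 := by
    intro s hs h0
    refine hγ s hs (hplaneN s hs _ fun x y => ?_)
    have h1 := hpar.compat x s hs
    have h2 := hpar.compat y s hs
    rw [h0, zero_mul, real_inner_comm] at h1 h2
    linarith
  refine ⟨c, a, b, fun s => b s / β s, ⟨hcs, has, hbs, ?_, hcompat⟩, hbs.div hpar.smooth_β hβ, ?_⟩
  · intro x s hs
    rw [hparam x s hs, unitField, smul_smul]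
  · intro s hs
    have hbl : b s = b s / β s * β s := (div_mul_cancel₀ _ (hβ s hs)).symm
    set l := b s / β s with hl
    have hinner : ∀ x : M₀, (inner ℝ (ambient N (x, s)) (deriv c s - l • deriv γ s) : ℝ) =
        l * deriv α s - deriv a s := by
      intro x
      have h1 := hcompat x s hs
      have h2 := hpar.compat x s hs
      rw [real_inner_comm] at h1 h2
      rw [inner_sub_right, inner_smul_right]
      have h3 : b s * ρ (x, s) = l * (β s * ρ (x, s)) := by rw [← mul_assoc, ← hbl]
      rw [← h2, ← h1] at h3
      linarith
    -- The right side of `hinner` is independent of `x`, so the leaf of `N` would lie in a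
    -- hyperplane were this vector nonzero.
    have hzero := hplaneN s hs (deriv c s - l • deriv γ s) fun x y => by rw [hinner, hinner]
    refine ⟨hbl, ?_, sub_eq_zero.1 hzero⟩
    have h4 := hinner x₀
    rw [hzero, inner_zero_right] at h4
    linarith
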